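/- Metric allocation with non-convex costs. Let $(M,d)$ be a metric space on $n\ge 1$ points and let $\Delta=\{x\in\mathbb{R}_{\ge 0}^M : \sum_{i\in M}x_i=1\}$. For $x,y\in\Delta$ let the movement cost $W(x,y)$ be the minimum of $\sum_{i,j\in M} f(i,j)\,d(i,j)$ over all flows $f\colon M\times M\to\mathbb{R}_{\ge 0}$ with $y_i-x_i=\sum_{j\in M}(f(j,i)-f(i,j))$ for all $i\in M$. An instance consists of an initial allocation $x(0)\in\Delta$ and a finite sequence of requests; the request at time $t=1,\dots,T$ is a family $c_t=(c_{t,i})_{i\in M}$ of non-increasing functions $c_{t,i}\colon[0,1]\to\mathbb{R}_{\ge 0}$, which need not be convex or continuous. A schedule $x(0),x(1),\dots,x(T)\in\Delta$ has cost $\sum_{t=1}^T\bigl(W(x(t-1),x(t))+\sum_{i\in M}c_{t,i}(x_i(t))\bigr)$. A deterministic online algorithm chooses $x(t)$ as a function of $x(0),c_1,\dots,c_t$; a randomized online algorithm is a random deterministic online algorithm. An online algorithm is $\rho$-competitive if there is a constant $C$, independent of the instance (but possibly depending on the metric space), such that on every instance its (expected) cost is at most $\rho$ times the cost of any schedule with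 the same initial allocation, plus $C$. There is a universal constant $K>0$ such that for every metric space $(M,d)$ on $n\ge 1$ points there is a $K n^2$-competitive deterministic online algorithm and, if $n\ge 2$, a $K n\log n$-competitive randomized online algorithm. -/

import Mathlib

open scoped NNReal
open MeasureTheory

namespace MetricAllocation

/-- Allocations of one unit of a resource to the points of `M`: the simplex
`{x : M → ℝ | 0 ≤ x i for all i, and ∑ i, x i = 1}`. -/
abbrev Alloc (M : Type*) [Fintype M] : Type _ := ↥(stdSimplex ℝ M)

/-- The amount of resource at the point `i`, as an element of `[0,1]`. -/
def Alloc.amount {M : Type*} [Fintype M] (x : Alloc M) (i : M) : unitInterval :=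
  ⟨x.1 i, mem_Icc_of_mem_stdSimplex x.2 i⟩

/-- A (possibly non-convex, possibly discontinuous) cost function at a single point:
a non-increasing function `[0,1] → ℝ₊`. -/
structure CostFun where
  toFun : unitInterval → ℝ≥0
  antitone' : Antitone toFun

/-- The tasks arriving at one time step: one cost function for each point. -/
abbrev Request (M : Type*) : Type _ := M → CostFun

/-- The service cost `∑ i, c i (x i)`. -/
noncomputable def serviceCost {M : Type*} [Fintype M] (c : Request M) (x : Alloc M) : ℝ :=
  ∑ i, ((c i).toFun (x.amount i) : ℝ)

/-- `f` is a flow with `f i j ≥ 0` units sent from `i` to `j`, whose net inflow at every point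
`i` is `z i`. -/
def IsFlow {M : Type*} [Fintype M] (f : M → M → ℝ) (z : M → ℝ) : Prop :=
  (∀ i j, 0 ≤ f i j) ∧ ∀ i, z i = ∑ j, (f j i - f i j)

/-- The movement cost of changing the allocation `x` to `y`: the smallest cost
`∑ i j, f i j * d(i,j)` of a flow that changes `x` to `y`. -/
noncomputable def moveCost {M : Type*} [Fintype M] [MetricSpace M] (x y : Alloc M) : ℝ :=
  sInf {a : ℝ | ∃ f : M → M → ℝ, IsFlow f (fun i => y.1 i - x.1 i) ∧
    a = ∑ i, ∑ j, f i j * dist i j}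

/-- The total cost (movement plus service) up to the horizon `T` of the schedule
`x 0, x 1, …, x T`, where `x 0` is the initial allocation and the request `σ t` is served in
`x (t + 1)`. -/
noncomputable def totalCost {M : Type*} [Fintype M] [MetricSpace M]
    (σ : ℕ → Request M) (x : ℕ → Alloc M) (T : ℕ) : ℝ :=
  ∑ t ∈ Finset.range T, (moveCost (x t) (x (t + 1)) + serviceCost (σ t) (x (t + 1)))

/-- A deterministic online algorithm: given the initial allocation and the requests
`0, …, t` revealed so far, it chooses the allocation that serves request `t`. -/
def DetAlg (M : Type*) [Fintype M] : Type _ :=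
  Alloc M → (t : ℕ) → (Fin (t + 1) → Request M) → Alloc M

/-- The schedule produced by a deterministic online algorithm from the initial allocation `x₀`
on the request sequence `σ`. -/
def DetAlg.run {M : Type*} [Fintype M] (A : DetAlg M) (x₀ : Alloc M) (σ : ℕ → Request M) :
    ℕ → Alloc M
  | 0 => x₀
  | t + 1 => A x₀ t (fun s => σ s)

/-- `A` is `ρ`-competitive: up to a fixed additive constant, on every input its cost is at most
`ρ` times the cost of every offline schedule with the same initial allocation. -/
def DetAlg.IsCompetitive {M : Type*} [Fintype M] [MetricSpace M] (A : DetAlg M) (ρ : ℝ) : Prop :=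
  ∃ C : ℝ, ∀ (x₀ : Alloc M) (σ : ℕ → Request M) (T : ℕ) (y : ℕ → Alloc M), y 0 = x₀ →
    totalCost σ (A.run x₀ σ) T ≤ ρ * totalCost σ y T + C

/-- A randomized online algorithm: a random deterministic online algorithm, i.e. a family of
deterministic online algorithms indexed by a probability space, such that the allocation chosen
after any given history is a random variable. -/
structure RandAlg (M : Type*) [Fintype M] where
  Ω : Type
  [measurableSpace : MeasurableSpace Ω]
  P : Measure Ω
  [isProbabilityMeasure : IsProbabilityMeasure P]
  alg : Ω → DetAlg M
  measurable_alg : ∀ (x₀ : Alloc M) (t : ℕ) (h : Fin (t + 1) → Request M),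
    Measurable (fun ω => alg ω x₀ t h)

attribute [instance] RandAlg.measurableSpace RandAlg.isProbabilityMeasure

/-- `R` is `ρ`-competitive (against oblivious adversaries): up to a fixed additive constant, on
every input its expected cost is (well defined and) at most `ρ` times the cost of every offline
schedule with the same initial allocation. -/
def RandAlg.IsCompetitive {M : Type*} [Fintype M] [MetricSpace M] (R : RandAlg M) (ρ : ℝ) : Prop :=
  ∃ C : ℝ, ∀ (x₀ : Alloc M) (σ : ℕ → Request M) (T : ℕ) (y : ℕ → Alloc M), y 0 = x₀ →
    Integrable (fun ω => totalCost σ ((R.alg ω).run x₀ σ) T) R.P ∧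
    ∫ ω, totalCost σ ((R.alg ω).run x₀ σ) T ∂(R.P) ≤ ρ * totalCost σ y T + C

end MetricAllocation

/-! One deterministic algorithm of competitive ratio `6 n` gives both bounds, since `6 n ≤ 12 n ^ 2`
and `log n ≥ 1 / 2` for `n ≥ 2`.

Choose conductances `a` on `M` that are cheap (total conductance times length at most `2 n`) and
still join any two points `j, k` with effective resistance at most `2 * dist j k`; an approximately
D-optimal design provides them (`exists_isSparseNetwork`). To serve a request, pull resource towards
each `i` by an amount `G i` that also pays for the service at `i`. Because costs are non-increasing,
such `G` are closed under minima, so there is a nearly least one (`exists_min_toppling`); convexity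
is never needed.

Let `g` be a voltage with Laplacian online minus offline, and `u` an upper bound for `g`. The
potential is `∑ i, pullWeight a i * (u - g i)`. The function `u + serviceCost c y - g` is itself an
admissible pull, leading to the offline allocation `y`, so it dominates `G` up to the error. Hence
adding `G` to `g` raises `u` by little more than the offline service cost, while the potential drops
by the online cost (`HasPotential.move_online`). Offline moves raise `u` by about twice their cost,
by the resistance bound. The total weight is at most `3 n`, whence `6 n`. -/

namespace MetricAllocation

/-! ### Approximate D-optimal designs -/

open Matrix in
/-- The matrix determinant lemma, with the solution `g` of `A g = b` in place of `A⁻¹ b`. -/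
theorem det_add_smul_vecMulVec {M : Type*} [Fintype M] [DecidableEq M] (A : Matrix M M ℝ)
    (b g : M → ℝ) (hg : A *ᵥ g = b) (s : ℝ) :
    (A + s • vecMulVec b b).det = A.det * (1 + s * (b ⬝ᵥ g)) := by
  have h : A + s • vecMulVec b b = A * (1 + vecMulVec (s • g) b) := by
    rw [mul_add, mul_one, mul_vecMulVec, mulVec_smul, hg, smul_vecMulVec]
  rw [h, det_mul, vecMulVec_eq Unit, det_one_add_replicateCol_mul_replicateRow, dotProduct_smul,
    smul_eq_mul]

open Matrix in
/-- The information matrix `∑ e, c e • v e (v e)ᵀ` of the design with weights `c`. -/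
noncomputable def infoMatrix {ι M : Type*} [Fintype ι] (v : ι → M → ℝ) (c : ι → ℝ) :
    Matrix M M ℝ :=
  ∑ e, c e • vecMulVec (v e) (v e)

open Matrix in
theorem infoMatrix_mulVec {ι M : Type*} [Fintype ι] [Fintype M] (v : ι → M → ℝ) (c : ι → ℝ)
    (g : M → ℝ) : infoMatrix v c *ᵥ g = ∑ e, (c e * (v e ⬝ᵥ g)) • v e := by
  unfold infoMatrix
  rw [sum_mulVec]
  refine Finset.sum_congr rfl fun e _ => ?_
  rw [smul_mulVec, vecMulVec_mulVec, mul_smul]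
  simp

open Matrix in
/-- Approximate D-optimal designs (Kiefer–Wolfowitz): the weights `c` can be chosen within a
budget such that the design is nondegenerate and every `v e` has variance at most twice its
price. -/
theorem exists_design {ι M : Type*} [Fintype ι] [Fintype M] [DecidableEq M] [Nonempty M]
    (v : ι → M → ℝ) (w : ι → ℝ) (hw : ∀ e, 0 < w e)
    (hv : ∀ g : M → ℝ, (∀ e, v e ⬝ᵥ g = 0) → g = 0) :
    ∃ c : ι → ℝ, (∀ e, 0 ≤ c e) ∧ ∑ e, c e * w e ≤ Fintype.card M ∧
      (∀ g, infoMatrix v c *ᵥ g = 0 → g = 0) ∧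
      ∀ e, ∃ g, infoMatrix v c *ᵥ g = v e ∧ v e ⬝ᵥ g ≤ 2 * w e := by
  classical
  set n : ℝ := (Fintype.card M : ℝ) with hn
  have hn1 : 1 ≤ n := by
    rw [hn]; exact_mod_cast Fintype.card_pos
  have hn0 : 0 < n := by linarith
  let F : Set (ι → ℝ) := {c | (∀ e, 0 ≤ c e) ∧ ∑ e, c e * w e ≤ n}
  have hclosed : IsClosed F := by
    refine IsClosed.inter (s₁ := {c : ι → ℝ | ∀ e, 0 ≤ c e})
      (s₂ := {c : ι → ℝ | ∑ e, c e * w e ≤ n}) ?_ ?_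
    · simp only [Set.ofPred_forall]
      exact isClosed_iInter fun e => isClosed_le continuous_const (continuous_apply e)
    · exact isClosed_le (by fun_prop) continuous_const
  have hcompact : IsCompact F := by
    refine (isCompact_univ_pi fun e => isCompact_Icc (a := 0) (b := n / w e)).of_isClosed_subset
      hclosed ?_
    rintro c ⟨h0, h1⟩ e -
    refine ⟨h0 e, ?_⟩
    rw [le_div_iff₀ (hw e)]
    exact (Finset.single_le_sum (f := fun e => c e * w e)
      (fun e _ => mul_nonneg (h0 e) (hw e).le) (Finset.mem_univ e)).trans h1
  have hcont : Continuous fun c : ι → ℝ => |(infoMatrix v c).det| := by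
    unfold infoMatrix
    fun_prop
  obtain ⟨c, ⟨hc0, hc1⟩, hmax⟩ := hcompact.exists_isMaxOn ⟨0, by simp [F, hn0.le]⟩
    hcont.continuousOn
  -- Small uniform weights are within the budget and give a positive definite matrix, so the maximum
  -- is not zero.
  have hdet : (infoMatrix v c).det ≠ 0 := by
    let W : ℝ := ∑ e, w e
    have hW : 0 ≤ W := Finset.sum_nonneg fun e _ => (hw e).le
    let τ : ℝ := n / (W + 1)
    have hτ : 0 < τ := by positivity
    have hmem : (fun _ => τ) ∈ F := by
      refine ⟨fun _ => hτ.le, ?_⟩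
      rw [← Finset.mul_sum]
      change n / (W + 1) * W ≤ n
      rw [div_mul_eq_mul_div, div_le_iff₀ (by positivity)]
      nlinarith
    have hpos : (infoMatrix v fun _ => τ).det ≠ 0 := by
      intro h0
      obtain ⟨g, hg, hg0⟩ := exists_mulVec_eq_zero_iff.mpr h0
      refine hg (hv g ?_)
      have h1 : g ⬝ᵥ (infoMatrix v (fun _ => τ) *ᵥ g) = 0 := by rw [hg0, dotProduct_zero]
      rw [infoMatrix_mulVec, dotProduct_sum] at h1
      have h2 : ∀ e, g ⬝ᵥ ((τ * (v e ⬝ᵥ g)) • v e) = τ * (v e ⬝ᵥ g) ^ 2 := by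
        intro e
        rw [dotProduct_smul, dotProduct_comm g, smul_eq_mul]; ring
      simp only [h2] at h1
      rw [Finset.sum_eq_zero_iff_of_nonneg (fun e _ => by positivity)] at h1
      intro e
      have := h1 e (Finset.mem_univ e)
      simpa [hτ.ne'] using this
    intro h0
    have := hmax hmem
    simp only [Set.mem_ofPred_eq, h0, abs_zero] at this
    exact hpos (abs_eq_zero.mp (le_antisymm this (abs_nonneg _)))
  refine ⟨c, hc0, hc1, fun g hg => ?_, fun e => ?_⟩
  · by_contra hne
    exact hdet (exists_mulVec_eq_zero_iff.mp ⟨g, hne, hg⟩)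
  · obtain ⟨g, hg⟩ : ∃ g, infoMatrix v c *ᵥ g = v e := ⟨(infoMatrix v c)⁻¹ *ᵥ v e, by
      rw [mulVec_mulVec, mul_nonsing_inv _ (isUnit_iff_ne_zero.mpr hdet), one_mulVec]⟩
    refine ⟨g, hg, ?_⟩
    have hwe := hw e
    -- Spend one more budget unit on `e` and rescale by `q⁻¹` to return to budget `n`. Optimality of
    -- `c` then yields `1 + (v e ⬝ᵥ g) / w e ≤ q ^ n ≤ exp 1 ≤ 3`.
    let q : ℝ := 1 + 1 / n
    have hq : 0 < q := by positivity
    let c' : ι → ℝ := q⁻¹ • (c + Pi.single e (1 / w e))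
    have hsum : ∑ x, (Pi.single e (1 / w e) : ι → ℝ) x * w x = 1 := by
      rw [Finset.sum_eq_single e]
      · simp [hwe.ne']
      · intro b _ hb; simp [hb]
      · simp
    have hmem : c' ∈ F := by
      refine ⟨fun x => ?_, ?_⟩
      · have : 0 ≤ (Pi.single e (1 / w e) : ι → ℝ) x := by
          by_cases hx : x = e
          · subst hx; simp [hwe.le]
          · simp [hx]
        have := hc0 x
        simp only [c', Pi.smul_apply, Pi.add_apply, smul_eq_mul]
        positivity
      · simp only [c', Pi.smul_apply, Pi.add_apply, smul_eq_mul, mul_assoc, add_mul]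
        rw [← Finset.mul_sum, Finset.sum_add_distrib, hsum, inv_mul_le_iff₀ hq]
        have : q * n = n + 1 := by simp only [q]; field_simp
        linarith
    have hmat : infoMatrix v c' = q⁻¹ • (infoMatrix v c + (1 / w e) • vecMulVec (v e) (v e)) := by
      simp only [infoMatrix, c', Pi.smul_apply, Pi.add_apply, smul_eq_mul, mul_smul, add_smul]
      rw [← Finset.smul_sum, Finset.sum_add_distrib]
      congr 2
      rw [Finset.sum_eq_single e]
      · simp
      · intro b _ hb; simp [hb]
      · simp
    have hle := hmax hmem
    simp only [Set.mem_ofPred_eq] at hle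
    rw [hmat, det_smul, det_add_smul_vecMulVec _ _ _ hg, abs_mul, abs_mul, abs_of_pos
      (pow_pos (inv_pos.mpr hq) _), inv_pow, inv_mul_le_iff₀ (pow_pos hq _), mul_comm (q ^ _),
      mul_le_mul_iff_right₀ (abs_pos.mpr hdet)] at hle
    have hq3 : q ^ Fintype.card M ≤ 3 := by
      have h1 : q ≤ Real.exp (1 / n) := by
        have := Real.add_one_le_exp (1 / n); simp only [q]; linarith
      calc q ^ Fintype.card M ≤ Real.exp (1 / n) ^ Fintype.card M := by gcongr
        _ = Real.exp 1 := by
          rw [← Real.exp_nat_mul, ← hn]; congr 1; field_simp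
        _ ≤ 3 := Real.exp_one_lt_three.le
    have h3 := (le_abs_self _).trans (hle.trans hq3)
    have h4 : 1 / w e * (v e ⬝ᵥ g) ≤ 2 := by linarith
    rwa [one_div, inv_mul_le_iff₀ hwe, mul_comm] at h4

/-! ### Network Laplacians and the maximum principle -/

/-- The weighted graph Laplacian of the conductances `a`. -/
def lap {M : Type*} [Fintype M] (a : M → M → ℝ) (g : M → ℝ) (i : M) : ℝ :=
  ∑ j, a i j * (g i - g j)

section Laplacian

variable {M : Type*} [Fintype M] (a : M → M → ℝ)

theorem lap_add (g h : M → ℝ) : lap a (g + h) = lap a g + lap a h := by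
  ext i
  simp only [lap, Pi.add_apply, ← Finset.sum_add_distrib]
  exact Finset.sum_congr rfl fun j _ => by ring

theorem lap_smul (r : ℝ) (g : M → ℝ) : lap a (r • g) = r • lap a g := by
  ext i
  simp only [lap, Pi.smul_apply, smul_eq_mul, Finset.mul_sum]
  exact Finset.sum_congr rfl fun j _ => by ring

theorem lap_neg (g : M → ℝ) : lap a (-g) = -lap a g := by
  simpa using lap_smul a (-1) g

theorem lap_sum {ι : Type*} (s : Finset ι) (g : ι → M → ℝ) :
    lap a (∑ e ∈ s, g e) = ∑ e ∈ s, lap a (g e) := by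
  classical
  induction s using Finset.induction_on with
  | empty => ext i; simp [lap]
  | insert e s he ih => rw [Finset.sum_insert he, Finset.sum_insert he, lap_add, ih]

theorem lap_const_sub (r : ℝ) (g : M → ℝ) : lap a (fun i => r - g i) = -lap a g := by
  ext i
  simp only [lap, Pi.neg_apply, ← Finset.sum_neg_distrib]
  exact Finset.sum_congr rfl fun j _ => by ring

theorem lap_sub_const (r : ℝ) (g : M → ℝ) : lap a (fun i => g i - r) = lap a g := by
  ext i
  simp only [lap]
  exact Finset.sum_congr rfl fun j _ => by ring

variable {a}

theorem sum_lap (hs : ∀ i j, a i j = a j i) (g : M → ℝ) : ∑ i, lap a g i = 0 := by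
  have h : ∑ i, lap a g i = -∑ i, lap a g i := by
    conv_lhs => simp only [lap]; rw [Finset.sum_comm]
    simp only [lap, ← Finset.sum_neg_distrib]
    refine Finset.sum_congr rfl fun i _ => Finset.sum_congr rfl fun j _ => ?_
    rw [hs j i]; ring
  linarith

/-- Maximum principle: in a connected network the potential of a unit current entering at `j`
and leaving at `k` is maximal at `j`. -/
theorem le_source (h0 : ∀ i j, 0 ≤ a i j) (hs : ∀ i j, a i j = a j i)
    (hker : ∀ g : M → ℝ, lap a g = 0 → ∀ i j, g i = g j) {g : M → ℝ} {j : M}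
    (hg : ∀ i, i ≠ j → lap a g i ≤ 0) (i : M) : g i ≤ g j := by
  classical
  obtain ⟨p, -, hp⟩ := Finset.exists_max_image Finset.univ g ⟨i, Finset.mem_univ i⟩
  by_contra hij
  have hjp : g j ≠ g p := fun h => hij (h ▸ hp i (Finset.mem_univ i))
  -- If the maximum is not attained at `j`, no conductance leaves the set where it is attained. The
  -- indicator of that set is then harmonic but not constant.
  have hzero : ∀ k l, g k = g p → g l ≠ g p → a k l = 0 := by
    intro k l hk hl
    have hkj : k ≠ j := fun h => hjp (h ▸ hk)
    have hnn : ∀ m ∈ Finset.univ, 0 ≤ a k m * (g k - g m) := fun m hm =>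
      mul_nonneg (h0 k m) (sub_nonneg.mpr (hk ▸ hp m hm))
    have hz := (Finset.sum_eq_zero_iff_of_nonneg hnn).mp
      (le_antisymm (hg k hkj) (Finset.sum_nonneg hnn)) l (Finset.mem_univ l)
    rcases mul_eq_zero.mp hz with h | h
    · exact h
    · exact absurd (by linarith) hl
  have hind : lap a (fun k => if g k = g p then 1 else 0) = 0 := by
    ext k
    refine Finset.sum_eq_zero fun l _ => ?_
    by_cases hk : g k = g p <;> by_cases hl : g l = g p
    · simp [hk, hl]
    · simp [hzero k l hk hl]
    · simp [hs k l, hzero l k hl hk]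
    · simp [hk, hl]
  have := hker _ hind j p
  simp [hjp] at this

end Laplacian

/-! ### Sparse networks of small effective resistance -/

/-- A network on the metric space `M` whose total conductance weighted by length is at most
`2 |M|`, and in which a unit current between two points needs a voltage of at most twice their
distance. -/
structure IsSparseNetwork {M : Type*} [Fintype M] [DecidableEq M] [MetricSpace M]
    (a : M → M → ℝ) : Prop where
  nonneg : ∀ i j, 0 ≤ a i j
  symm : ∀ i j, a i j = a j i
  weight_le : ∑ i, ∑ j, a i j * dist i j ≤ 2 * Fintype.card M
  exists_current : ∀ j k, ∃ φ : M → ℝ, lap a φ = Pi.single j 1 - Pi.single k 1 ∧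
    ∀ i, 0 ≤ φ i ∧ φ i ≤ 2 * dist j k

-- The information matrix of the edge vectors is a Laplacian, and variance is effective resistance.
-- The extra all-ones vector `none` removes the degeneracy on constants. Loops get the dummy price 1
-- because prices must be positive.
open Matrix in
theorem exists_isSparseNetwork (M : Type*) [Fintype M] [DecidableEq M] [Nonempty M]
    [MetricSpace M] : ∃ a : M → M → ℝ, IsSparseNetwork a := by
  let v : Option (M × M) → M → ℝ := fun e =>
    e.elim 1 fun p => Pi.single p.1 1 - Pi.single p.2 1
  let w : Option (M × M) → ℝ := fun e =>
    e.elim 1 fun p => if p.1 = p.2 then 1 else dist p.1 p.2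
  have hvp : ∀ j k (g : M → ℝ), v (some (j, k)) ⬝ᵥ g = g j - g k := by
    intro j k g
    simp [v, sub_dotProduct]
  have hvapp : ∀ j k i, v (some (j, k)) i = (if i = j then 1 else 0) - if i = k then 1 else 0 := by
    intro j k i
    simp [v, Pi.single_apply]
  have hv1 : ∀ g : M → ℝ, v none ⬝ᵥ g = ∑ i, g i := by
    intro g
    simp [v, dotProduct]
  have hw : ∀ e, 0 < w e := by
    rintro (_ | ⟨j, k⟩)
    · exact one_pos
    · by_cases h : j = k
      · simp [w, h]
      · simp [w, h]
  obtain ⟨c, hc0, hc1, hker, hcur⟩ := exists_design v w hw (by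
    intro g hg
    have hconst : ∀ j k, g j = g k := fun j k => by
      have := hg (some (j, k)); rw [hvp] at this; linarith
    have h1 := hg none
    rw [hv1] at h1
    ext i
    have : ∑ k, g k = Fintype.card M * g i := by
      rw [Finset.sum_congr rfl fun k _ => hconst k i]; simp
    rw [this] at h1
    simpa using h1)
  let a : M → M → ℝ := fun i j => c (some (i, j)) + c (some (j, i))
  have ha0 : ∀ i j, 0 ≤ a i j := fun i j => add_nonneg (hc0 _) (hc0 _)
  have has : ∀ i j, a i j = a j i := fun i j => add_comm _ _
  have hA : ∀ g : M → ℝ, infoMatrix v c *ᵥ g = (fun _ => c none * ∑ i, g i) + lap a g := by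
    intro g
    rw [infoMatrix_mulVec, Fintype.sum_option, hv1]
    congr 1
    · ext i; simp [v]
    · ext i
      rw [Fintype.sum_prod_type, Finset.sum_apply]
      simp only [Finset.sum_apply, hvp, hvapp, Pi.smul_apply, smul_eq_mul, mul_sub,
        Finset.sum_sub_distrib, mul_ite, mul_one, mul_zero, Finset.sum_ite_eq, Finset.mem_univ,
        if_true, lap, a]
      rw [Finset.sum_comm]
      simp only [Finset.sum_ite_eq, Finset.mem_univ, if_true, ← Finset.sum_sub_distrib]
      exact Finset.sum_congr rfl fun j _ => by ring
  have hlapker : ∀ g : M → ℝ, lap a g = 0 → ∀ i j, g i = g j := by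
    intro g hg i j
    let r : ℝ := (∑ i, g i) / Fintype.card M
    have h0 := hker (fun i => g i - r) (by
      rw [hA, lap_sub_const, hg]
      ext i
      have : ∑ i, (g i - r) = 0 := by
        rw [Finset.sum_sub_distrib]
        simp only [r, Finset.sum_const, Finset.card_univ, nsmul_eq_mul]
        field_simp
        simp
      simp [this])
    have hi := congrFun h0 i
    have hj := congrFun h0 j
    simp only [Pi.zero_apply] at hi hj
    linarith
  refine ⟨a, ha0, has, ?_, fun j k => ?_⟩
  · have h1 : ∑ i, ∑ j, a i j * dist i j = 2 * ∑ i, ∑ j, c (some (i, j)) * dist i j := by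
      simp only [a, add_mul, Finset.sum_add_distrib]
      rw [two_mul]
      congr 1
      rw [Finset.sum_comm]
      simp only [dist_comm]
    have h2 : ∑ i, ∑ j, c (some (i, j)) * dist i j ≤ ∑ e, c e * w e := by
      rw [Fintype.sum_option, Fintype.sum_prod_type]
      have : 0 ≤ c none * w none := mul_nonneg (hc0 _) (hw _).le
      refine le_add_of_nonneg_of_le this ?_
      refine Finset.sum_le_sum fun i _ => Finset.sum_le_sum fun j _ => ?_
      refine mul_le_mul_of_nonneg_left ?_ (hc0 _)
      by_cases h : i = j <;> simp [w, h]
    rw [h1]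
    linarith
  · by_cases hjk : j = k
    · subst hjk
      exact ⟨0, by simpa using lap_smul a 0 0, fun i => by simp⟩
    obtain ⟨g, hg, hle⟩ := hcur (some (j, k))
    rw [hvp] at hle
    simp only [w, Option.elim_some, hjk, if_false] at hle
    rw [hA] at hg
    have hlap : lap a g = Pi.single j 1 - Pi.single k 1 := by
      -- Summing over coordinates kills the Laplacian and the right-hand side, so the all-ones part
      -- vanishes.
      have hsum : ∑ i, ((fun _ => c none * ∑ i, g i) + lap a g : M → ℝ) i = ∑ i, v (some (j, k)) i := by
        rw [hg]
      simp only [Pi.add_apply, Finset.sum_add_distrib, sum_lap has, Finset.sum_const,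
        Finset.card_univ, nsmul_eq_mul, add_zero, hvapp, Finset.sum_sub_distrib,
        Finset.sum_ite_eq', Finset.mem_univ, if_true, sub_self] at hsum
      have hz : c none * ∑ i, g i = 0 := by simpa using hsum
      rw [hz] at hg
      have : (fun _ => 0 : M → ℝ) + lap a g = lap a g := zero_add _
      rw [← this, hg]
      rfl
    have hmax : ∀ i, g i ≤ g j := le_source ha0 has hlapker fun i hi => by
      rw [hlap]
      simp only [Pi.sub_apply, Pi.single_apply, hi, if_false]
      split_ifs <;> norm_num
    have hmin : ∀ i, (-g) i ≤ (-g) k := le_source ha0 has hlapker fun i hi => by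
      rw [lap_neg, hlap]
      simp only [Pi.neg_apply, Pi.sub_apply, Pi.single_apply, hi, if_false]
      split_ifs <;> norm_num
    refine ⟨fun i => g i - g k, by rw [lap_sub_const, hlap], fun i => ?_⟩
    have h1 := hmax i
    have h2 := hmin i
    simp only [Pi.neg_apply] at h2
    constructor <;> linarith

/-! ### Service costs and flows -/

theorem serviceCost_nonneg {M : Type*} [Fintype M] (c : Request M) (x : Alloc M) : 0 ≤ serviceCost c x :=
  Finset.sum_nonneg fun _ _ => NNReal.coe_nonneg _

section MoveCost

variable {M : Type*} [Fintype M] [MetricSpace M]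

theorem flowCost_nonneg {f : M → M → ℝ} (hf : ∀ i j, 0 ≤ f i j) :
    0 ≤ ∑ i, ∑ j, f i j * dist i j :=
  Finset.sum_nonneg fun i _ => Finset.sum_nonneg fun j _ => mul_nonneg (hf i j) dist_nonneg

theorem moveCost_nonneg (x y : Alloc M) : 0 ≤ moveCost x y := by
  refine Real.sInf_nonneg ?_
  rintro _ ⟨f, hf, rfl⟩
  exact flowCost_nonneg hf.1

theorem moveCost_le {x y : Alloc M} {f : M → M → ℝ} (hf : IsFlow f fun i => y.1 i - x.1 i) :
    moveCost x y ≤ ∑ i, ∑ j, f i j * dist i j := by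
  refine csInf_le ⟨0, ?_⟩ ⟨f, hf, rfl⟩
  rintro _ ⟨f, hf, rfl⟩
  exact flowCost_nonneg hf.1

theorem exists_flow_lt (x y : Alloc M) {ε : ℝ} (hε : 0 < ε) :
    ∃ f : M → M → ℝ, IsFlow f (fun i => y.1 i - x.1 i) ∧
      ∑ i, ∑ j, f i j * dist i j < moveCost x y + ε := by
  have hne : {a : ℝ | ∃ f : M → M → ℝ, IsFlow f (fun i => y.1 i - x.1 i) ∧
      a = ∑ i, ∑ j, f i j * dist i j}.Nonempty := by
    refine ⟨_, fun i j => x.1 i * y.1 j, ⟨fun i j => mul_nonneg (x.2.1 i) (y.2.1 j), fun i => ?_⟩,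
      rfl⟩
    rw [Finset.sum_sub_distrib, ← Finset.sum_mul, ← Finset.mul_sum, x.2.2, y.2.2]
    ring
  obtain ⟨_, ⟨f, hf, rfl⟩, hlt⟩ := Real.lt_sInf_add_pos hne hε
  exact ⟨f, hf, hlt⟩

theorem totalCost_nonneg (σ : ℕ → Request M) (x : ℕ → Alloc M) (T : ℕ) : 0 ≤ totalCost σ x T :=
  Finset.sum_nonneg fun _ _ => add_nonneg (moveCost_nonneg _ _) (serviceCost_nonneg _ _)

end MoveCost

/-! ### Least topplings and the online algorithm -/

section Toppling

variable {M : Type*} [Fintype M]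

/-- Pulling `G i` units of resource towards every point `i` turns the allocation `x` into `y`,
and `G i` pays for the service at `i` in `y`. -/
def IsToppling (a : M → M → ℝ) (c : Request M) (x y : Alloc M) (G : M → ℝ) : Prop :=
  lap a G = (fun i => y.1 i - x.1 i) ∧ ∀ i, ((c i).toFun (y.amount i) : ℝ) ≤ G i

theorem IsToppling.nonneg {a : M → M → ℝ} {c : Request M} {x y : Alloc M} {G : M → ℝ}
    (h : IsToppling a c x y G) (i : M) : 0 ≤ G i :=
  (NNReal.coe_nonneg _).trans (h.2 i)

/-- Topplings are closed under pointwise minima. -/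
theorem IsToppling.inf {a : M → M → ℝ} (h0 : ∀ i j, 0 ≤ a i j) (hs : ∀ i j, a i j = a j i)
    {c : Request M} {x y z : Alloc M} {G H : M → ℝ}
    (hG : IsToppling a c x y G) (hH : IsToppling a c x z H) :
    ∃ u, IsToppling a c x u (G ⊓ H) := by
  -- Where `G` attains the minimum, lowering the other values only increases the inflow. The point
  -- ends with at least `y i`, so its service costs no more.
  have key : ∀ {G H : M → ℝ} {y : Alloc M}, IsToppling a c x y G → ∀ i, G i ≤ H i →
      y.1 i ≤ x.1 i + lap a (G ⊓ H) i := by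
    intro G H y hG i hi
    have h1 : lap a G i ≤ lap a (G ⊓ H) i := by
      refine Finset.sum_le_sum fun j _ => mul_le_mul_of_nonneg_left ?_ (h0 i j)
      simp only [Pi.inf_apply, inf_eq_left.mpr hi]
      linarith [inf_le_left (a := G j) (b := H j)]
    rw [hG.1] at h1
    linarith
  have key' : ∀ i, H i ≤ G i → z.1 i ≤ x.1 i + lap a (G ⊓ H) i := fun i hi => by
    rw [inf_comm]; exact key hH i hi
  let u : Alloc M := ⟨fun i => x.1 i + lap a (G ⊓ H) i, fun i => by
    rcases le_total (G i) (H i) with h | h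
    · exact (y.2.1 i).trans (key hG i h)
    · exact (z.2.1 i).trans (key' i h), by
    rw [Finset.sum_add_distrib, sum_lap hs, x.2.2, add_zero]⟩
  refine ⟨u, by ext i; simp [u], fun i => ?_⟩
  rcases le_total (G i) (H i) with h | h
  · rw [Pi.inf_apply, inf_eq_left.mpr h]
    refine le_trans ?_ (hG.2 i)
    exact_mod_cast (c i).antitone' (show y.amount i ≤ u.amount i from key hG i h)
  · rw [Pi.inf_apply, inf_eq_right.mpr h]
    refine le_trans ?_ (hH.2 i)
    exact_mod_cast (c i).antitone' (show z.amount i ≤ u.amount i from key' i h)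

/-- There is a toppling that is pointwise minimal up to `ε`. -/
theorem exists_min_toppling [Nonempty M] {a : M → M → ℝ} (h0 : ∀ i j, 0 ≤ a i j)
    (hs : ∀ i j, a i j = a j i) (c : Request M) (x : Alloc M) {ε : ℝ} (hε : 0 < ε) :
    ∃ y G, IsToppling a c x y G ∧
      ∀ z H, IsToppling a c x z H → ∀ i, G i ≤ H i + ε := by
  let F : Set (M → ℝ) := {G | ∃ y, IsToppling a c x y G}
  have hne : F.Nonempty := by
    refine ⟨fun _ => serviceCost c x, x, ?_, fun i => ?_⟩
    · ext i; simp [lap]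
    · exact Finset.single_le_sum (f := fun i => ((c i).toFun (x.amount i) : ℝ))
        (fun _ _ => NNReal.coe_nonneg _) (Finset.mem_univ i)
  have hbdd : ∀ i, BddBelow ((fun G : M → ℝ => G i) '' F) := by
    rintro i
    refine ⟨0, ?_⟩
    rintro _ ⟨G, ⟨y, hG⟩, rfl⟩
    exact hG.nonneg i
  have hex : ∀ i, ∃ G ∈ F, G i < sInf ((fun G : M → ℝ => G i) '' F) + ε := by
    intro i
    obtain ⟨_, ⟨G, hG, rfl⟩, hlt⟩ := Real.lt_sInf_add_pos (hne.image fun G : M → ℝ => G i) hε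
    exact ⟨G, hG, hlt⟩
  choose G hGF hG using hex
  -- The minimum of one nearly optimal toppling per coordinate is nearly optimal everywhere. The
  -- costs may be discontinuous, so an error `ε` is allowed.
  have hmem : Finset.univ.inf' Finset.univ_nonempty G ∈ F :=
    Finset.inf'_mem F (fun G hG H hH => by
      obtain ⟨y, hy⟩ := hG
      obtain ⟨z, hz⟩ := hH
      exact hy.inf h0 hs hz) _ _ _ fun i _ => hGF i
  obtain ⟨y, hy⟩ := hmem
  refine ⟨y, _, hy, fun z H hH i => ?_⟩
  have h1 : (Finset.univ.inf' Finset.univ_nonempty G) i ≤ G i i :=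
    Finset.inf'_le G (Finset.mem_univ i) i
  have h2 : sInf ((fun G : M → ℝ => G i) '' F) ≤ H i := csInf_le (hbdd i) ⟨H, ⟨z, hH⟩, rfl⟩
  linarith [hG i]

/-- Pulling `G i` towards `i` sends `a i j * G i` from each `j` to `i`; opposite flows need not be
cancelled. -/
theorem IsToppling.moveCost_le [MetricSpace M] {a : M → M → ℝ} (h0 : ∀ i j, 0 ≤ a i j)
    (hs : ∀ i j, a i j = a j i) {c : Request M} {x y : Alloc M} {G : M → ℝ}
    (hG : IsToppling a c x y G) :
    moveCost x y ≤ ∑ i, (∑ j, a i j * dist i j) * G i := by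
  refine (MetricAllocation.moveCost_le (f := fun j i => a i j * G i)
    ⟨fun j i => mul_nonneg (h0 i j) (hG.nonneg i), fun i => ?_⟩).trans_eq ?_
  · refine (congrFun hG.1 i).symm.trans ?_
    refine Finset.sum_congr rfl fun j _ => ?_
    simp only [hs j i]; ring
  · rw [Finset.sum_comm]
    refine Finset.sum_congr rfl fun i _ => ?_
    rw [Finset.sum_mul]
    refine Finset.sum_congr rfl fun j _ => ?_
    rw [dist_comm]; ring

open Classical in
/-- The allocation reached from `x` by an almost minimal toppling for the request `c`. -/
noncomputable def topple (a : M → M → ℝ) (c : Request M) (ε : ℝ) (x : Alloc M) : Alloc M :=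
  if h : ∃ y G, IsToppling a c x y G ∧ ∀ z H, IsToppling a c x z H → ∀ i, G i ≤ H i + ε then
    h.choose else x

/-- The schedule that topples with error `2⁻ᵗ` at time `t`. -/
noncomputable def toppleSchedule (a : M → M → ℝ) (x₀ : Alloc M) (σ : ℕ → Request M) :
    ℕ → Alloc M
  | 0 => x₀
  | t + 1 => topple a (σ t) ((1 / 2) ^ t) (toppleSchedule a x₀ σ t)

theorem toppleSchedule_congr (a : M → M → ℝ) (x₀ : Alloc M) {σ τ : ℕ → Request M} {T : ℕ}
    (h : ∀ t < T, σ t = τ t) : toppleSchedule a x₀ σ T = toppleSchedule a x₀ τ T := by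
  induction T with
  | zero => rfl
  | succ T ih =>
    rw [toppleSchedule, toppleSchedule, ih fun t ht => h t (ht.trans T.lt_succ_self),
      h T T.lt_succ_self]

/-- The toppling algorithm on the network `a`. -/
noncomputable def toppleAlg (a : M → M → ℝ) : DetAlg M := fun x₀ t h =>
  -- Indices beyond `t` wrap around but are never read.
  toppleSchedule a x₀ (fun s => h (Fin.ofNat (t + 1) s)) (t + 1)

theorem toppleAlg_run (a : M → M → ℝ) (x₀ : Alloc M) (σ : ℕ → Request M) (T : ℕ) :
    (toppleAlg a).run x₀ σ T = toppleSchedule a x₀ σ T := by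
  cases T with
  | zero => rfl
  | succ T =>
    refine toppleSchedule_congr a x₀ fun t ht => ?_
    simp [Fin.ofNat, Nat.mod_eq_of_lt ht]

end Toppling

/-! ### Potential function and competitive analysis -/

section Algorithm

variable {M : Type*} [Fintype M] [MetricSpace M]

/-- The rate `1 + ∑ j, a i j * dist i j` at which pulling resource towards `i` is paid for. -/
noncomputable def pullWeight (a : M → M → ℝ) (i : M) : ℝ :=
  1 + ∑ j, a i j * dist i j

/-- The voltage `g` certifies that the potential of the pair of allocations `x` (online) and `y`
(offline) is at most `p`. -/
def HasPotential (a : M → M → ℝ) (x y : Alloc M) (p : ℝ) : Prop :=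
  ∃ (g : M → ℝ) (u : ℝ), lap a g = (fun i => x.1 i - y.1 i) ∧ (∀ i, g i ≤ u) ∧
    (∑ i, pullWeight a i) * u - ∑ i, pullWeight a i * g i ≤ p

theorem HasPotential.refl (a : M → M → ℝ) (x : Alloc M) : HasPotential a x x 0 :=
  ⟨0, 0, by ext i; simp [lap], fun i => le_rfl, by simp⟩

variable [DecidableEq M]

theorem IsSparseNetwork.pullWeight_pos {a : M → M → ℝ} (ha : IsSparseNetwork a) (i : M) :
    0 < pullWeight a i :=
  add_pos_of_pos_of_nonneg one_pos
    (Finset.sum_nonneg fun j _ => mul_nonneg (ha.nonneg i j) dist_nonneg)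

theorem IsSparseNetwork.sum_pullWeight_nonneg {a : M → M → ℝ} (ha : IsSparseNetwork a) :
    0 ≤ ∑ i, pullWeight a i :=
  Finset.sum_nonneg fun i _ => (ha.pullWeight_pos i).le

theorem IsSparseNetwork.sum_pullWeight_le {a : M → M → ℝ} (ha : IsSparseNetwork a) :
    ∑ i, pullWeight a i ≤ 3 * Fintype.card M := by
  simp only [pullWeight, Finset.sum_add_distrib]
  have := ha.weight_le
  simp only [Finset.sum_const, Finset.card_univ, nsmul_eq_mul, mul_one]
  linarith

theorem HasPotential.nonneg {a : M → M → ℝ} (ha : IsSparseNetwork a) {x y : Alloc M} {p : ℝ}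
    (h : HasPotential a x y p) : 0 ≤ p := by
  obtain ⟨g, u, -, hu, hp⟩ := h
  refine le_trans ?_ hp
  rw [Finset.sum_mul, ← Finset.sum_sub_distrib]
  exact Finset.sum_nonneg fun i _ => sub_nonneg.mpr
    (mul_le_mul_of_nonneg_left (hu i) (ha.pullWeight_pos i).le)

/-- Superposing the unit currents along a nearly optimal flow corrects `g` by a `ψ` between 0 and
twice the flow cost. -/
theorem HasPotential.move_offline {a : M → M → ℝ} (ha : IsSparseNetwork a) {x y : Alloc M}
    {p : ℝ} (h : HasPotential a x y p) (z : Alloc M) {ε : ℝ} (hε : 0 < ε) :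
    HasPotential a x z (p + (∑ i, pullWeight a i) * (2 * (moveCost y z + ε))) := by
  obtain ⟨g, u, hg, hu, hp⟩ := h
  obtain ⟨f, ⟨hf0, hf⟩, hlt⟩ := exists_flow_lt y z hε
  choose φ hφ hφ0 using ha.exists_current
  let ψ : M → ℝ := ∑ j, ∑ k, f j k • φ j k
  have hψapp : ∀ i, ψ i = ∑ j, ∑ k, f j k * φ j k i := fun i => by
    simp [ψ, Finset.sum_apply]
  have hψ0 : ∀ i, 0 ≤ ψ i := fun i => by
    rw [hψapp]
    exact Finset.sum_nonneg fun j _ => Finset.sum_nonneg fun k _ =>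
      mul_nonneg (hf0 j k) (hφ0 j k i).1
  have hψ1 : ∀ i, ψ i ≤ 2 * ∑ j, ∑ k, f j k * dist j k := fun i => by
    rw [hψapp, Finset.mul_sum]
    refine Finset.sum_le_sum fun j _ => ?_
    rw [Finset.mul_sum]
    refine Finset.sum_le_sum fun k _ => ?_
    calc f j k * φ j k i ≤ f j k * (2 * dist j k) :=
          mul_le_mul_of_nonneg_left (hφ0 j k i).2 (hf0 j k)
      _ = _ := by ring
  have hlapψ : lap a ψ = fun i => y.1 i - z.1 i := by
    simp only [ψ, lap_sum, lap_smul, hφ]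
    ext i
    have h1 := hf i
    simp only [Finset.sum_sub_distrib] at h1
    simp only [Finset.sum_apply, Pi.smul_apply, Pi.sub_apply, smul_eq_mul, mul_sub,
      Finset.sum_sub_distrib, Pi.single_apply, mul_ite, mul_one, mul_zero, Finset.sum_ite_eq,
      Finset.mem_univ, if_true]
    rw [Finset.sum_comm]
    simp only [Finset.sum_ite_eq, Finset.mem_univ, if_true]
    linarith
  refine ⟨g + ψ, u + 2 * (moveCost y z + ε), ?_, fun i => ?_, ?_⟩
  · rw [lap_add, hg, hlapψ]
    ext i
    simp
  · have := hu i
    have := hψ1 i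
    simp only [Pi.add_apply]
    linarith
  · have h1 : ∑ i, pullWeight a i * g i ≤ ∑ i, pullWeight a i * (g + ψ) i :=
      Finset.sum_le_sum fun i _ => mul_le_mul_of_nonneg_left
        (by simpa using hψ0 i) (ha.pullWeight_pos i).le
    rw [mul_add]
    linarith

theorem HasPotential.move_online {a : M → M → ℝ} (ha : IsSparseNetwork a) {c : Request M}
    {x x' y : Alloc M} {p ε : ℝ} (h : HasPotential a x y p) {G : M → ℝ}
    (hG : IsToppling a c x x' G)
    (hmin : ∀ z H, IsToppling a c x z H → ∀ i, G i ≤ H i + ε) :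
    HasPotential a x' y (p + (∑ i, pullWeight a i) * (serviceCost c y + ε) -
      (moveCost x x' + serviceCost c x')) := by
  obtain ⟨g, u, hg, hu, hp⟩ := h
  have hcost : moveCost x x' + serviceCost c x' ≤ ∑ i, pullWeight a i * G i := by
    simp only [pullWeight, add_mul, one_mul, Finset.sum_add_distrib]
    have h1 := hG.moveCost_le ha.nonneg ha.symm
    have h2 : serviceCost c x' ≤ ∑ i, G i := Finset.sum_le_sum fun i _ => hG.2 i
    linarith
  -- The offline allocation yields a competing toppling, which bounds `G` and hence `g + G`.
  have hH : IsToppling a c x y fun i => u + serviceCost c y - g i := by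
    refine ⟨?_, fun i => ?_⟩
    · rw [lap_const_sub, hg]
      ext i
      simp
    · have h1 : ((c i).toFun (y.amount i) : ℝ) ≤ serviceCost c y :=
        Finset.single_le_sum (f := fun i => ((c i).toFun (y.amount i) : ℝ))
          (fun _ _ => NNReal.coe_nonneg _) (Finset.mem_univ i)
      linarith [hu i]
  refine ⟨g + G, u + serviceCost c y + ε, ?_, fun i => ?_, ?_⟩
  · rw [lap_add, hg, hG.1]
    ext i
    simp
  · have := hmin y _ hH i
    simp only [Pi.add_apply]
    linarith
  · simp only [Pi.add_apply, mul_add, Finset.sum_add_distrib] at hcost ⊢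
    linarith

/-- Each step costs three errors: two from the doubled offline move and one from the toppling. They
form a geometric series, which ends up in the additive constant. -/
theorem hasPotential_toppleSchedule [Nonempty M] {a : M → M → ℝ} (ha : IsSparseNetwork a)
    (σ : ℕ → Request M) (y : ℕ → Alloc M) (T : ℕ) :
    HasPotential a (toppleSchedule a (y 0) σ T) (y T)
      ((∑ i, pullWeight a i) * (2 * totalCost σ y T + 3 * ∑ t ∈ Finset.range T, (1 / 2) ^ t) -
        totalCost σ (toppleSchedule a (y 0) σ) T) := by
  induction T with
  | zero => simpa [totalCost, toppleSchedule] using HasPotential.refl a (y 0)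
  | succ T ih =>
    have hε : (0 : ℝ) < (1 / 2) ^ T := by positivity
    have hex := exists_min_toppling ha.nonneg ha.symm (σ T) (toppleSchedule a (y 0) σ T) hε
    have hstep : toppleSchedule a (y 0) σ (T + 1) = hex.choose := by
      rw [toppleSchedule, topple, dif_pos hex]
    obtain ⟨G, hG, hmin⟩ := hex.choose_spec
    rw [← hstep] at hG
    obtain ⟨g, u, hg, hu, hp⟩ := (ih.move_offline ha (y (T + 1)) hε).move_online ha hG hmin
    refine ⟨g, u, hg, hu, hp.trans ?_⟩
    simp only [totalCost, Finset.sum_range_succ]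
    have := mul_nonneg ha.sum_pullWeight_nonneg (serviceCost_nonneg (σ T) (y (T + 1)))
    simp only [mul_add] at this ⊢
    linarith

/-- On every metric space with `n` points the toppling algorithm is `6 n`-competitive. -/
theorem toppleAlg_isCompetitive [Nonempty M] {a : M → M → ℝ} (ha : IsSparseNetwork a) {ρ : ℝ}
    (hρ : 6 * Fintype.card M ≤ ρ) : (toppleAlg a).IsCompetitive ρ := by
  refine ⟨(∑ i, pullWeight a i) * 6, ?_⟩
  rintro x₀ σ T y rfl
  have hrun : (toppleAlg a).run (y 0) σ = toppleSchedule a (y 0) σ :=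
    funext (toppleAlg_run a (y 0) σ)
  rw [hrun]
  have hpot := (hasPotential_toppleSchedule ha σ y T).nonneg ha
  have hgeom : ∑ t ∈ Finset.range T, ((1 : ℝ) / 2) ^ t ≤ 2 := sum_geometric_two_le T
  have hS := ha.sum_pullWeight_le
  have h1 := mul_le_mul_of_nonneg_left hgeom ha.sum_pullWeight_nonneg
  have h2 := mul_le_mul_of_nonneg_right (hS.trans (by linarith : _ ≤ ρ / 2))
    (totalCost_nonneg σ y T)
  simp only [mul_add] at hpot
  linarith

end Algorithm

/-! ### Randomized algorithms and the conclusion -/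

/-- A deterministic algorithm, as a randomized algorithm that uses no randomness. -/
noncomputable def DetAlg.toRandAlg {M : Type*} [Fintype M] (A : DetAlg M) : RandAlg M where
  Ω := Unit
  P := Measure.dirac ()
  alg := fun _ => A
  measurable_alg := fun _ _ _ => measurable_const

theorem DetAlg.IsCompetitive.toRandAlg {M : Type*} [Fintype M] [MetricSpace M] {A : DetAlg M}
    {ρ : ℝ} (h : A.IsCompetitive ρ) : A.toRandAlg.IsCompetitive ρ := by
  obtain ⟨C, hC⟩ := h
  refine ⟨C, fun x₀ σ T y hy => ⟨integrable_const (μ := A.toRandAlg.P) (totalCost σ (A.run x₀ σ) T), ?_⟩⟩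
  change ∫ _, totalCost σ (A.run x₀ σ) T ∂A.toRandAlg.P ≤ _
  rw [integral_const, probReal_univ, one_smul]
  exact hC x₀ σ T y hy

end MetricAllocation

/-- There is a universal constant `K` such that every `n`-point metric space admits a
`K n²`-competitive deterministic and, if `n ≥ 2`, a `K n log n`-competitive randomized online
algorithm for metric allocation with non-increasing, not necessarily convex cost functions. -/
theorem corollary5 :
    ∃ K : ℝ, 0 < K ∧ ∀ (M : Type*) [Fintype M] [Nonempty M] [MetricSpace M],
      (∃ A : MetricAllocation.DetAlg M,
        A.IsCompetitive (K * (Fintype.card M : ℝ) ^ 2)) ∧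
      (2 ≤ Fintype.card M →
        ∃ R : MetricAllocation.RandAlg M,
          R.IsCompetitive (K * ((Fintype.card M : ℝ) * Real.log (Fintype.card M)))) := by
  refine ⟨12, by norm_num, fun M _ _ _ => ?_⟩
  classical
  obtain ⟨a, ha⟩ := MetricAllocation.exists_isSparseNetwork M
  have hn : (1 : ℝ) ≤ Fintype.card M := by exact_mod_cast Fintype.card_pos (α := M)
  refine ⟨⟨MetricAllocation.toppleAlg a, MetricAllocation.toppleAlg_isCompetitive ha ?_⟩,
    fun h2 => ⟨(MetricAllocation.toppleAlg a).toRandAlg,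
      (MetricAllocation.toppleAlg_isCompetitive ha ?_).toRandAlg⟩⟩
  · nlinarith
  · have h2' : (2 : ℝ) ≤ Fintype.card M := by exact_mod_cast h2
    have hlog : 1 / 2 ≤ Real.log (Fintype.card M) := by
      have := Real.log_le_log (by norm_num) h2'
      linarith [Real.log_two_gt_d9]
    nlinarith
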